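/- Let $q>2$ be a prime power, and let $V$ be a $3$-dimensional vector space over $\mathbb F_{q^3}$. Then $V$ has dimension $9$ over $\mathbb F_q$; write $\mathrm{PG}(2,q^3)$ and $\mathrm{PG}(8,q)$ for the projective spaces of $V$ over $\mathbb F_{q^3}$ and over $\mathbb F_q$. Each point $\bar P$ of $\mathrm{PG}(2,q^3)$, being a $1$-dimensional $\mathbb F_{q^3}$-subspace of $V$, is a $3$-dimensional $\mathbb F_q$-subspace, hence a plane $[\![P]\!]$ of $\mathrm{PG}(8,q)$; these planes form a regular (Desarguesian) $2$-spread of $\mathrm{PG}(8,q)$. Let $\phi$ be a collineation of $\mathrm{PG}(2,q^3)$ of order $3$ which fixes pointwise an $\mathbb F_q$-plane, that is, the set of all points having coordinates in $\mathbb F_q$ with respect to some $\mathbb F_{q^3}$-basis of $V$. Let $\sigma\in\mathrm{PGL}(9,q)$ be a projectivity of $\mathrm{PG}(8,q)$ induced by $\phi$, that is, $\sigma$ maps $[\![P]\!]$ onto $[\![P^\phi]\!]$ for every point $\bar P$ of $\mathrm{PG}(2,q^3)$. A point $\bar P$ of $\mathrm{PG}(2,q^3)$ has Type I if $\bar P^\phi=\bar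 P$, and Type II if $\bar P,\bar P^\phi,\bar P^{\phi^2}$ are three distinct collinear points. A point $A$ of $\mathrm{PG}(8,q)$ is a $\mathrm I_:$-point if it lies in $[\![P]\!]$ for some $\bar P$ of Type I and $A,A^\sigma,A^{\sigma^2}$ are distinct and collinear; it is a $\mathrm{II}_:$-point if it lies in $[\![P]\!]$ for some $\bar P$ of Type II and $A,A^\sigma,A^{\sigma^2}$ are collinear. For $X\in\{\mathrm I,\mathrm{II}\}$, a fixed-$X$-line is a line of $\mathrm{PG}(8,q)$ that is fixed (setwise) by $\sigma$ and contains an $X_:$-point. A hwise-fixed $5$-space is a $5$-dimensional projective subspace of $\mathrm{PG}(8,q)$ such that every hyperplane of $\mathrm{PG}(8,q)$ containing it is fixed by $\sigma$. Then: 1. every $\mathrm I_:$-point and every $\mathrm{II}_:$-point of $\mathrm{PG}(8,q)$ is contained in a unique hwise-fixed $5$-space; 2. every fixed-$\mathrm I$-line and every fixed-$\mathrm{II}$-line is contained in a unique hwise-fixed $5$-space. -/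

import Mathlib

open scoped LinearAlgebra.Projectivization

namespace FieldReduction

section General

variable {F E : Type*} [Field F] [AddCommGroup E] [Module F E]

/-- A linear subspace `U` of `E`, seen as a subspace of the projective space of `E`, has
projective dimension `d` (a line has `d = 1`, a plane has `d = 2`). -/
def HasProjDim (U : Submodule F E) (d : ℕ) : Prop :=
  Module.finrank F U = d + 1

/-- Three (not necessarily distinct) points of a projective space lie on a common line. -/
def CollinearPoints (P Q R : ℙ F E) : Prop :=
  Projectivization.IsCollinear {P, Q, R}

/-- The points `P, Q, R` are pairwise distinct and lie on a common line. -/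
def ThreeCollinear (P Q R : ℙ F E) : Prop :=
  P ≠ Q ∧ Q ≠ R ∧ P ≠ R ∧ CollinearPoints P Q R

/-- A permutation of the points of a projective space is a collineation if it preserves
collinearity in both directions. -/
def IsCollineation (φ : Equiv.Perm (ℙ F E)) : Prop :=
  ∀ P Q R : ℙ F E, CollinearPoints (φ P) (φ Q) (φ R) ↔ CollinearPoints P Q R

/-- The action on points of the projectivity given by an invertible linear map. -/
def proj (g : E ≃ₗ[F] E) : ℙ F E → ℙ F E :=
  Projectivization.map (g : E →ₗ[F] E) g.injective

/-- The projectivity given by `g` fixes the subspace `U` (setwise). -/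
def Fixes (g : E ≃ₗ[F] E) (U : Submodule F E) : Prop :=
  U.map (g : E →ₗ[F] E) = U

end General

section Bose

variable (K : Type*) {L V : Type*} [Field K] [Field L] [Algebra K L] [AddCommGroup V]
  [Module L V] [Module K V] [IsScalarTower K L V]

/-- `S` is a `K`-plane (a subplane over `K`) of the projective plane `ℙ L V`: for some `L`-basis
of `V`, it is the set of points with homogeneous coordinates in `K`. -/
def IsSubplane (S : Set (ℙ L V)) : Prop :=
  ∃ b : Module.Basis (Fin 3) L V,
    S = {P | ∃ (k : Fin 3 → K) (h : ∑ i, algebraMap K L (k i) • b i ≠ 0),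
      P = Projectivization.mk L (∑ i, algebraMap K L (k i) • b i) h}

/-- The spread plane of `ℙ K V` that corresponds to the point `P` of `ℙ L V`. -/
def spreadPlane (P : ℙ L V) : Submodule K V :=
  P.submodule.restrictScalars K

variable {K}

/-- The projectivity of `ℙ K V` given by `g` is induced by the permutation `φ` of the points of
`ℙ L V`: it acts on the spread planes as `φ` acts on the points. -/
def IsInducedBy (g : V ≃ₗ[K] V) (φ : Equiv.Perm (ℙ L V)) : Prop :=
  ∀ P : ℙ L V, (spreadPlane K P).map (g : V →ₗ[K] V) = spreadPlane K (φ P)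

/-- The orbit of the point `P` of `ℙ L V` under `φ` is a single point. -/
def IsTypeI (φ : Equiv.Perm (ℙ L V)) (P : ℙ L V) : Prop :=
  φ P = P

/-- The orbit of the point `P` of `ℙ L V` under `φ` (of order `3`) is three collinear points. -/
def IsTypeII (φ : Equiv.Perm (ℙ L V)) (P : ℙ L V) : Prop :=
  ThreeCollinear P (φ P) (φ (φ P))

/-- A point of `ℙ K V` that lies in the spread plane of a Type I point. -/
def IsIPoint (φ : Equiv.Perm (ℙ L V)) (A : ℙ K V) : Prop :=
  ∃ P : ℙ L V, IsTypeI φ P ∧ A.submodule ≤ spreadPlane K P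

/-- A point of `ℙ K V` that lies in the spread plane of a Type II point. -/
def IsIIPoint (φ : Equiv.Perm (ℙ L V)) (A : ℙ K V) : Prop :=
  ∃ P : ℙ L V, IsTypeII φ P ∧ A.submodule ≤ spreadPlane K P

/-- `I:`-points: I-points with `A`, `A^σ`, `A^σ²` distinct and collinear. -/
def IsIColonPoint (φ : Equiv.Perm (ℙ L V)) (g : V ≃ₗ[K] V) (A : ℙ K V) : Prop :=
  IsIPoint φ A ∧ ThreeCollinear A (proj g A) (proj g (proj g A))

/-- `II:`-points: II-points with `A`, `A^σ`, `A^σ²` collinear. -/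
def IsIIColonPoint (φ : Equiv.Perm (ℙ L V)) (g : V ≃ₗ[K] V) (A : ℙ K V) : Prop :=
  IsIIPoint φ A ∧ CollinearPoints A (proj g A) (proj g (proj g A))

/-- A fixed-I-line: a fixed line of `ℙ K V` containing an `I:`-point. -/
def IsFixedILine (φ : Equiv.Perm (ℙ L V)) (g : V ≃ₗ[K] V) (l : Submodule K V) : Prop :=
  HasProjDim l 1 ∧ Fixes g l ∧ ∃ A : ℙ K V, IsIColonPoint φ g A ∧ A.submodule ≤ l

/-- A fixed-II-line: a fixed line of `ℙ K V` containing a `II:`-point. -/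
def IsFixedIILine (φ : Equiv.Perm (ℙ L V)) (g : V ≃ₗ[K] V) (l : Submodule K V) : Prop :=
  HasProjDim l 1 ∧ Fixes g l ∧ ∃ A : ℙ K V, IsIIColonPoint φ g A ∧ A.submodule ≤ l

/-- A hyperplane-wise fixed 5-space of `ℙ K V` (of projective dimension 8): every hyperplane
(7-space) through it is fixed. -/
def IsHwiseFixed5Space (g : V ≃ₗ[K] V) (U : Submodule K V) : Prop :=
  HasProjDim U 5 ∧ ∀ H : Submodule K V, HasProjDim H 7 → U ≤ H → Fixes g H

end Bose

end FieldReduction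

/-!
Since `σ` maps one-dimensional `L`-subspaces to such subspaces, it is semilinear with respect to
some `θ ∈ Gal(L/K)`. As `φ` fixes a subplane pointwise, `σ` multiplies some `L`-basis of `V` by a
scalar `c`; then `θ ≠ 1` because `φ ≠ 1`, so `θ` generates the Galois group, and `σ ^ 3` is the
scalar `n = N(c) ∈ K`.

By duality, all hyperplanes through `U` are fixed iff the transpose of `σ` is a scalar `a` on the
annihilator of `U`, that is, iff `U` contains the range of `σ - a`. This range is everything unless
`a ^ 3 = n`. If `a ^ 3 = n`, Hilbert 90 turns the basis into one with `σ b = a b`; by the additive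
Hilbert 90, the range of `σ - a` consists of the vectors whose coordinates have trace zero, so it
has codimension `3`, and it is also the kernel of `σ ^ 2 + a σ + a ^ 2`. The hwise-fixed 5-spaces
are therefore exactly these ranges.

If `v` and `σ v` are independent and span a `σ`-invariant line, `σ ^ 2 v = α σ v + β v`, then
`σ ^ 3 = n` forces `β = -α ^ 2` and `n = -α ^ 3`, so `v` lies in the range of `σ - a` with
`a ^ 3 = n` for `a = -α` and for no other `a`.
-/

namespace FieldReduction

section CommonMultiplier

variable {L V W : Type*} [Field L] [AddCommGroup V] [AddCommGroup W] [Module L W]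

theorem eq_of_apply_eq_smul_of_linearIndependent {f g : V →+ W} {c : V → L}
    (hc : ∀ v, f v = c v • g v) {v w : V} (h : LinearIndependent L ![g v, g w]) : c v = c w := by
  have hadd : (c (v + w) - c v) • g v + (c (v + w) - c w) • g w = 0 := by
    have := hc (v + w)
    rw [map_add, map_add, hc v, hc w] at this
    linear_combination (norm := module) -this
  obtain ⟨hv, hw⟩ := LinearIndependent.pair_iff.1 h _ _ hadd
  exact (sub_eq_zero.1 hv).symm.trans (sub_eq_zero.1 hw)

theorem exists_forall_apply_eq_smul {f g : V →+ W} (h : ∀ v, f v ∈ Submodule.span L {g v})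
    {u w : V} (huw : LinearIndependent L ![g u, g w]) : ∃ c : L, ∀ v, f v = c • g v := by
  choose c hc using fun v => Submodule.mem_span_singleton.1 (h v)
  replace hc (v : V) : f v = c v • g v := (hc v).symm
  refine ⟨c u, fun v => ?_⟩
  by_cases hv : g v = 0
  · rw [hc, hv, smul_zero, smul_zero]
  suffices c v = c u by rw [hc, this]
  by_cases hvu : LinearIndependent L ![g v, g u]
  · exact eq_of_apply_eq_smul_of_linearIndependent hc hvu
  have hvw : LinearIndependent L ![g v, g w] := by
    refine (LinearIndependent.pair_iff' hv).2 fun t ht => huw.ne_zero 0 ?_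
    rw [LinearIndependent.pair_iff' hv] at hvu
    push Not at hvu
    obtain ⟨s, hs⟩ := hvu
    have hst : t • g u + (-s) • g w = 0 := by
      rw [← hs, ← ht]
      module
    have hs0 : s = 0 := neg_eq_zero.1 (LinearIndependent.pair_iff.1 huw _ _ hst).2
    exact hs.symm.trans (by rw [hs0, zero_smul])
  exact (eq_of_apply_eq_smul_of_linearIndependent hc hvw).trans
    (eq_of_apply_eq_smul_of_linearIndependent hc huw).symm

theorem exists_forall_apply_basis_eq_smul {ι : Type*} [Fintype ι] {g : W →+ W}
    (b : Module.Basis ι L W) (hb : ∀ i, g (b i) ∈ Submodule.span L {b i})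
    (hsum : g (∑ i, b i) ∈ Submodule.span L {∑ i, b i}) : ∃ c : L, ∀ i, g (b i) = c • b i := by
  choose c hc using fun i => Submodule.mem_span_singleton.1 (hb i)
  obtain ⟨d, hd⟩ := Submodule.mem_span_singleton.1 hsum
  refine ⟨d, fun i => ?_⟩
  have hcd : ∑ i, c i • b i = ∑ i, d • b i := by
    rw [← Finset.smul_sum, hd, map_sum, Finset.sum_congr rfl fun i _ => hc i]
  rw [← hc, b.linearIndependent.eq_coords_of_eq hcd]

theorem exists_forall_mem_apply_eq_smul [Module L V] {f : Module.End L V} {U : Submodule L V}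
    (h : ∀ v ∈ U, ∃ c : L, f v = c • v) : ∃ a : L, ∀ v ∈ U, f v = a • v := by
  have hU : ∀ v ∈ U, f v ∈ U := fun v hv => by
    obtain ⟨c, hc⟩ := h v hv
    exact hc ▸ U.smul_mem c hv
  have hdep (v : U) : ¬ LinearIndependent L ![v, f.restrict hU v] := fun hli => by
    obtain ⟨c, hc⟩ := h v v.2
    have hc' : c • v + (-1 : L) • f.restrict hU v = 0 := Subtype.ext (by simp [hc])
    exact neg_ne_zero.2 one_ne_zero (LinearIndependent.pair_iff.1 hli _ _ hc').2
  obtain ⟨a, ha⟩ := LinearMap.exists_eq_smul_id_of_forall_notLinearIndependent hdep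
  exact ⟨a, fun v hv => congrArg Subtype.val (LinearMap.congr_fun ha ⟨v, hv⟩)⟩

theorem exists_algHom_map_smul {K : Type*} [Field K] [Algebra K L] [Module L V] [Module K V]
    [IsScalarTower K L V] [Module K W] [IsScalarTower K L W] {g : V →ₗ[K] W}
    (hg : ∀ (x : L) (v : V), g (x • v) ∈ Submodule.span L {g v}) {u w : V}
    (huw : LinearIndependent L ![g u, g w]) :
    ∃ θ : L →ₐ[K] L, ∀ (x : L) (v : V), g (x • v) = θ x • g v := by
  have hx (x : L) : ∃ y : L, ∀ v, g (x • v) = y • g v :=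
    exists_forall_apply_eq_smul
      (f := g.toAddMonoidHom.comp (DistribSMul.toAddMonoidHom V x)) (g := g.toAddMonoidHom)
      (hg x) huw
  choose θ hθ using hx
  have hu : g u ≠ 0 := huw.ne_zero 0
  refine ⟨AlgHom.ofLinearMap
    { toFun := θ
      map_add' := fun x y => smul_left_injective L hu ?_
      map_smul' := fun k x => smul_left_injective L hu ?_ }
    (smul_left_injective L hu ?_) fun x y => smul_left_injective L hu ?_, hθ⟩
  · simp only [add_smul, ← hθ, map_add]
  · simp only [RingHom.id_apply, smul_assoc, ← hθ, map_smul]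
  · simp [← hθ]
  · simp [mul_smul, ← hθ]

end CommonMultiplier

section Cyclic

variable {K L : Type*} [Field K] [Field L] [Algebra K L]

theorem isGalois_of_prime_finrank_of_ne_one (hL : (Module.finrank K L).Prime) {θ : Gal(L/K)}
    (hθ : θ ≠ 1) : IsGalois K L := by
  have : FiniteDimensional K L := .of_finrank_pos hL.pos
  have := IntermediateField.isSimpleOrder_of_finrank_prime K L hL
  refine IsGalois.of_fixedField_eq_bot _ _ ((eq_bot_or_eq_top _).resolve_right fun h => hθ ?_)
  ext x
  have hx : x ∈ IntermediateField.fixedField (⊤ : Subgroup Gal(L/K)) :=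
    h ▸ IntermediateField.mem_top
  exact IntermediateField.mem_fixedField_iff _ _ |>.1 hx θ (Subgroup.mem_top θ)

theorem mem_zpowers_of_prime_finrank [IsGalois K L] (hL : (Module.finrank K L).Prime)
    {θ : Gal(L/K)} (hθ : θ ≠ 1) (τ : Gal(L/K)) : τ ∈ Subgroup.zpowers θ := by
  have : FiniteDimensional K L := .of_finrank_pos hL.pos
  have : Fact (Module.finrank K L).Prime := ⟨hL⟩
  exact mem_zpowers_of_prime_card (IsGalois.card_aut_eq_finrank K L) hθ

theorem linearIndependent_coe_pow (θ : Gal(L/K)) :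
    LinearIndependent L fun i : Fin (orderOf θ) => ⇑(θ ^ (i : ℕ)) := by
  refine (linearIndependent_monoidHom L L).comp
    (fun i : Fin (orderOf θ) => ((θ ^ (i : ℕ) : Gal(L/K)) : L →* L))
    fun i j hij => Fin.ext (pow_injOn_Iio_orderOf i.2 j.2 ?_)
  exact AlgEquiv.ext (DFunLike.congr_fun hij :)

variable [FiniteDimensional K L] [IsGalois K L] {θ : Gal(L/K)}

theorem orderOf_eq_finrank (hθ : ∀ τ, τ ∈ Subgroup.zpowers θ) : orderOf θ = Module.finrank K L :=
  (orderOf_eq_card_of_forall_mem_zpowers hθ).trans (IsGalois.card_aut_eq_finrank K L)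

theorem mem_range_algebraMap_of_apply_eq_self (hθ : ∀ τ, τ ∈ Subgroup.zpowers θ) {x : L}
    (hx : θ x = x) : x ∈ Set.range (algebraMap K L) := by
  rw [IsGalois.mem_range_algebraMap_iff_fixed]
  have hθx : θ ∈ MulAction.stabilizer Gal(L/K) x := hx
  exact fun τ => Subgroup.zpowers_le.2 hθx (hθ τ)

theorem algebraMap_trace_eq_sum_pow (hθ : ∀ τ, τ ∈ Subgroup.zpowers θ) (x : L) :
    algebraMap K L (Algebra.trace K L x) =
      ∑ i ∈ Finset.range (Module.finrank K L), (θ ^ i) x := by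
  classical
  rw [trace_eq_sum_automorphisms, ← IsCyclic.image_range_orderOf hθ, orderOf_eq_finrank hθ,
    Finset.sum_image]
  simpa [orderOf_eq_finrank hθ] using pow_injOn_Iio_orderOf (x := θ)

theorem algebraMap_norm_eq_prod_pow (hθ : ∀ τ, τ ∈ Subgroup.zpowers θ) (x : L) :
    algebraMap K L (Algebra.norm K x) =
      ∏ i ∈ Finset.range (Module.finrank K L), (θ ^ i) x := by
  classical
  rw [Algebra.norm_eq_prod_automorphisms, ← IsCyclic.image_range_orderOf hθ,
    orderOf_eq_finrank hθ, Finset.prod_image]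
  simpa [orderOf_eq_finrank hθ] using pow_injOn_Iio_orderOf (x := θ)

theorem exists_apply_sub_eq_of_trace_eq_zero (hθ : ∀ τ, τ ∈ Subgroup.zpowers θ) {x : L}
    (hx : Algebra.trace K L x = 0) : ∃ y, θ y - y = x := by
  set D : L →ₗ[K] L := θ.toLinearMap - LinearMap.id with hD
  have hker : Module.finrank K (LinearMap.ker D) ≤ 1 := by
    refine (Submodule.finrank_mono (t := LinearMap.range (Algebra.linearMap K L)) fun y hy =>
      mem_range_algebraMap_of_apply_eq_self hθ (sub_eq_zero.1 hy)).trans ?_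
    simpa using LinearMap.finrank_range_le (Algebra.linearMap K L)
  have hrange : LinearMap.range D ≤ LinearMap.ker (Algebra.trace K L) := by
    rintro _ ⟨y, rfl⟩
    simp [hD, Algebra.trace_eq_of_algEquiv]
  have heq : LinearMap.range D = LinearMap.ker (Algebra.trace K L) := by
    refine Submodule.eq_of_le_of_finrank_le hrange ?_
    have := D.finrank_range_add_finrank_ker
    have := Module.Dual.finrank_ker_add_one_of_ne_zero (Algebra.trace_ne_zero K L)
    omega
  exact heq.ge hx

theorem exists_ne_zero_mul_apply_eq_of_norm_eq_one (hθ : ∀ τ, τ ∈ Subgroup.zpowers θ) {x : L}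
    (hx : Algebra.norm K x = 1) : ∃ y ≠ 0, x * θ y = y := by
  -- The Lagrange resolvent `∑ i, p i * θ ^ i z` is the required `y` as soon as it is nonzero.
  let p (i : ℕ) : L := ∏ j ∈ Finset.range i, (θ ^ j) x
  have hp (i : ℕ) : x * θ (p i) = p (i + 1) := by
    simp only [p, map_prod, Finset.prod_range_succ', pow_succ', AlgEquiv.mul_apply, pow_zero,
      AlgEquiv.one_apply, mul_comm]
  have hpd : p (orderOf θ) = 1 := by
    rw [orderOf_eq_finrank hθ, ← map_one (algebraMap K L), ← hx, algebraMap_norm_eq_prod_pow hθ]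
  obtain ⟨z, hz⟩ : ∃ z, ∑ i ∈ Finset.range (orderOf θ), p i * (θ ^ i) z ≠ 0 := by
    by_contra! h
    have h0 := Fintype.linearIndependent_iff.1 (linearIndependent_coe_pow θ) (fun i => p i)
      (funext fun z => by simpa [Finset.sum_range] using h z) ⟨0, orderOf_pos θ⟩
    simp [p] at h0
  refine ⟨_, hz, ?_⟩
  have hshift (i : ℕ) : x * θ (p i * (θ ^ i) z) = p (i + 1) * (θ ^ (i + 1)) z := by
    rw [map_mul, ← mul_assoc, hp, pow_succ', AlgEquiv.mul_apply]
  have hcyc : p (orderOf θ) * (θ ^ orderOf θ) z = p 0 * (θ ^ 0) z := by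
    rw [hpd, pow_orderOf_eq_one, pow_zero]
    rfl
  rw [map_sum, Finset.mul_sum, Finset.sum_congr rfl fun i _ => hshift i, ← sub_eq_zero,
    ← Finset.sum_sub_distrib, Finset.sum_range_sub fun i => p i * (θ ^ i) z, hcyc, sub_self]

end Cyclic

section Eigenrange

variable {K V : Type*} [Field K] [AddCommGroup V] [Module K V]

/-- The range of `f - a`. The hyperplanes through it are the kernels of the `a`-eigenvectors of the
transpose of `f`, so every one of them is invariant under `f`. -/
def eigenrange (f : Module.End K V) (a : K) : Submodule K V :=
  LinearMap.range (f - a • 1)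

/-- The value at `f` of the polynomial `(X ^ n - a ^ n) / (X - a)`. If `f ^ n = a ^ n`, it vanishes
on the range of `f - a`. -/
def geomSum (f : Module.End K V) (a : K) (n : ℕ) : Module.End K V :=
  ∑ i ∈ Finset.range n, f ^ i * (a • 1) ^ (n - 1 - i)

theorem mem_eigenrange {f : Module.End K V} {a : K} {v : V} :
    v ∈ eigenrange f a ↔ ∃ w, f w - a • w = v :=
  Iff.rfl

theorem apply_sub_smul_mem_eigenrange (f : Module.End K V) (a : K) (v : V) :
    f v - a • v ∈ eigenrange f a :=
  mem_eigenrange.2 ⟨v, rfl⟩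

theorem eigenrange_eq_top_of_pow_ne {f : Module.End K V} {a n : K} {d : ℕ} (hf : f ^ d = n • 1)
    (ha : a ^ d ≠ n) : eigenrange f a = ⊤ := by
  have hgeom : (f - a • 1) * geomSum f a d = (n - a ^ d) • 1 := by
    rw [geomSum, Commute.mul_geom_sum₂ ((Commute.one_right f).smul_right a), hf, smul_pow, one_pow,
      sub_smul]
  refine Submodule.eq_top_iff'.2 fun v => ?_
  rw [← Submodule.smul_mem_iff _ (sub_ne_zero.2 ha.symm)]
  exact ⟨geomSum f a d v, LinearMap.congr_fun hgeom v⟩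

theorem geomSum_three_apply (f : Module.End K V) (a : K) (v : V) :
    geomSum f a 3 v = f (f v) + a • f v + a ^ 2 • v := by
  simp only [geomSum, Finset.sum_range_succ, Finset.sum_range_zero, smul_pow, one_pow, mul_smul_one,
    LinearMap.add_apply, LinearMap.smul_apply, Module.End.mul_apply, pow_succ, pow_zero,
    one_mul, Module.End.one_apply, zero_add, Nat.add_one_sub_one, tsub_self, one_smul]
  abel

theorem existsUnique_geomSum_three_apply_eq_zero {f : Module.End K V} {n : K} (hf : f ^ 3 = n • 1)
    {v : V} (hli : LinearIndependent K ![v, f v])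
    (hmem : f (f v) ∈ Submodule.span K {v, f v}) :
    ∃! a : K, a ^ 3 = n ∧ geomSum f a 3 v = 0 := by
  obtain ⟨β, α, h⟩ := Submodule.mem_span_pair.1 hmem
  have hcube : n • v = α • f (f v) + β • f v := by
    have hfh := congrArg f h
    rw [map_add, map_smul, map_smul] at hfh
    rw [add_comm, hfh]
    exact (LinearMap.congr_fun hf v).symm
  rw [← h] at hcube
  obtain ⟨hn, hβ⟩ := LinearIndependent.pair_iff.1 hli (α * β - n) (α ^ 2 + β) (by
    linear_combination (norm := module) -hcube)
  have hgeom (a : K) : geomSum f a 3 v = (a ^ 2 + β) • v + (a + α) • f v := by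
    rw [geomSum_three_apply, ← h]
    module
  refine ⟨-α, ⟨by linear_combination hn - α * hβ, ?_⟩, fun a ⟨_, ha⟩ => ?_⟩
  · rw [hgeom, neg_sq, hβ, neg_add_cancel, zero_smul, zero_smul, add_zero]
  · rw [hgeom] at ha
    exact eq_neg_of_add_eq_zero_left (LinearIndependent.pair_iff.1 hli _ _ ha).2

end Eigenrange

section TraceCoord

variable {K L V ι : Type*} [Field K] [Field L] [Algebra K L] [AddCommGroup V] [Module L V]
  [Module K V] [IsScalarTower K L V]

theorem repr_smul_of_tower (b : Module.Basis ι L V) (a : K) (v : V) (i : ι) :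
    b.repr (a • v) i = a • b.repr v i := by
  rw [← algebraMap_smul L a v, map_smul, Finsupp.smul_apply, algebraMap_smul]

variable (K) in
/-- The `K`-linear map sending a vector to the traces of its coordinates in a basis over the
extension `L` of `K`. For a basis of `a`-eigenvectors of a semilinear map `f`, its kernel is the
range of `f - a`. -/
noncomputable def traceCoord (b : Module.Basis ι L V) : V →ₗ[K] ι → K :=
  LinearMap.pi fun i => Algebra.trace K L ∘ₗ (b.coord i).restrictScalars K

theorem traceCoord_apply (b : Module.Basis ι L V) (v : V) (i : ι) :
    traceCoord K b v i = Algebra.trace K L (b.repr v i) :=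
  rfl

theorem traceCoord_surjective [FiniteDimensional K L] [Algebra.IsSeparable K L] [Finite ι]
    (b : Module.Basis ι L V) : Function.Surjective (traceCoord K b) := by
  cases nonempty_fintype ι
  intro k
  choose x hx using fun i => Algebra.trace_surjective K L (k i)
  exact ⟨∑ i, x i • b i, funext fun i => by rw [traceCoord_apply, b.repr_sum_self, hx]⟩

end TraceCoord

section Semilinear

variable {K L V ι : Type*} [Field K] [Field L] [Algebra K L] [AddCommGroup V] [Module L V]
  [Module K V] {θ : Gal(L/K)} {f : Module.End K V} {b : Module.Basis ι L V}

theorem exists_basis_apply_eq_smul [FiniteDimensional K L] [IsGalois K L]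
    [IsScalarTower K L V] (hθ : ∀ τ, τ ∈ Subgroup.zpowers θ)
    (hf : ∀ (x : L) (v : V), f (x • v) = θ x • f v) {c : L} (hb : ∀ i, f (b i) = c • b i) {a : K}
    (ha : a ≠ 0) (hnorm : a ^ Module.finrank K L = Algebra.norm K c) :
    ∃ b' : Module.Basis ι L V, ∀ i, f (b' i) = a • b' i := by
  have ha' : algebraMap K L a ≠ 0 := (map_ne_zero _).2 ha
  have hca : Algebra.norm K (c * (algebraMap K L a)⁻¹) = 1 := by
    rw [map_mul, Algebra.norm_inv, Algebra.norm_algebraMap, ← hnorm,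
      mul_inv_cancel₀ (pow_ne_zero _ ha)]
  obtain ⟨y, hy, hcy⟩ := exists_ne_zero_mul_apply_eq_of_norm_eq_one hθ hca
  have hy' : θ y * c = algebraMap K L a * y := by
    conv_rhs => rw [← hcy]
    field_simp
  refine ⟨b.unitsSMul fun _ => Units.mk0 y hy, fun i => ?_⟩
  simp only [Module.Basis.unitsSMul_apply, Units.smul_mk0, hf, hb, smul_smul, hy',
    ← algebraMap_smul L a]

theorem repr_apply (hf : ∀ (x : L) (v : V), f (x • v) = θ x • f v) {c : L}
    (hb : ∀ i, f (b i) = c • b i) (v : V) (i : ι) : b.repr (f v) i = c * θ (b.repr v i) := by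
  obtain ⟨w, rfl⟩ := b.repr.symm.surjective v
  rw [LinearEquiv.apply_symm_apply]
  induction w using Finsupp.induction_linear with
  | zero => simp only [map_zero, Finsupp.zero_apply, mul_zero]
  | add x y hx hy => simp only [map_add, Finsupp.add_apply, hx, hy, mul_add]
  | single j x =>
    rcases eq_or_ne j i with rfl | hji
    · simp [hf, hb, mul_comm]
    · simp [hf, hb, hji]

theorem repr_pow_apply (hf : ∀ (x : L) (v : V), f (x • v) = θ x • f v) {c : L}
    (hb : ∀ i, f (b i) = c • b i) (k : ℕ) (v : V) (i : ι) :
    b.repr ((f ^ k) v) i = (∏ j ∈ Finset.range k, (θ ^ j) c) * (θ ^ k) (b.repr v i) := by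
  induction k with
  | zero => simp
  | succ k ih =>
    rw [pow_succ', Module.End.mul_apply, repr_apply hf hb, ih, map_mul, map_prod,
      Finset.prod_range_succ']
    simp only [pow_succ', AlgEquiv.mul_apply, pow_zero, AlgEquiv.one_apply]
    ring

variable [FiniteDimensional K L] [IsGalois K L] [IsScalarTower K L V]

theorem pow_finrank_eq_norm_smul (hθ : ∀ τ, τ ∈ Subgroup.zpowers θ)
    (hf : ∀ (x : L) (v : V), f (x • v) = θ x • f v) {c : L} (hb : ∀ i, f (b i) = c • b i) :
    f ^ Module.finrank K L = Algebra.norm K c • (1 : Module.End K V) := by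
  ext v
  refine b.repr.injective (Finsupp.ext fun i => ?_)
  rw [repr_pow_apply hf hb, ← algebraMap_norm_eq_prod_pow hθ, ← orderOf_eq_finrank hθ,
    pow_orderOf_eq_one, LinearMap.smul_apply, repr_smul_of_tower, Algebra.smul_def]
  rfl

theorem eigenrange_eq_ker_traceCoord [Finite ι] (hθ : ∀ τ, τ ∈ Subgroup.zpowers θ)
    (hf : ∀ (x : L) (v : V), f (x • v) = θ x • f v) {a : K} (ha : a ≠ 0)
    (hb : ∀ i, f (b i) = a • b i) :
    eigenrange f a = LinearMap.ker (traceCoord K b) := by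
  have hrepr (w : V) (i : ι) :
      b.repr (f w - a • w) i = a • (θ (b.repr w i) - b.repr w i) := by
    simp_rw [← algebraMap_smul L a (_ : V)] at hb
    rw [map_sub, Finsupp.sub_apply, repr_apply hf hb, repr_smul_of_tower, smul_sub,
      ← Algebra.smul_def]
  ext v
  rw [mem_eigenrange, LinearMap.mem_ker]
  constructor
  · rintro ⟨w, rfl⟩
    ext i
    rw [traceCoord_apply, hrepr, map_smul, map_sub, Algebra.trace_eq_of_algEquiv, sub_self,
      smul_zero, Pi.zero_apply]
  · intro hv
    cases nonempty_fintype ι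
    choose y hy using fun i => exists_apply_sub_eq_of_trace_eq_zero hθ (congrFun hv i)
    refine ⟨a⁻¹ • ∑ i, y i • b i, b.repr.injective (Finsupp.ext fun i => ?_)⟩
    rw [map_smul, smul_comm, ← smul_sub, repr_smul_of_tower, hrepr, b.repr_sum_self, hy,
      inv_smul_smul₀ ha]
    rfl

theorem finrank_eigenrange_add_card [Fintype ι] [FiniteDimensional K V]
    (hθ : ∀ τ, τ ∈ Subgroup.zpowers θ)
    (hf : ∀ (x : L) (v : V), f (x • v) = θ x • f v) {a : K} (ha : a ≠ 0)
    (hb : ∀ i, f (b i) = a • b i) :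
    Module.finrank K (eigenrange f a) + Fintype.card ι = Module.finrank K V := by
  rw [eigenrange_eq_ker_traceCoord hθ hf ha hb, add_comm, ← Module.finrank_fintype_fun_eq_card K,
    ← finrank_top K (ι → K), ← LinearMap.range_eq_top.2 (traceCoord_surjective b),
    LinearMap.finrank_range_add_finrank_ker]

theorem repr_geomSum_apply (hθ : ∀ τ, τ ∈ Subgroup.zpowers θ)
    (hf : ∀ (x : L) (v : V), f (x • v) = θ x • f v) {a : K}
    (hb : ∀ i, f (b i) = a • b i) (v : V) (i : ι) :
    b.repr (geomSum f a (Module.finrank K L) v) i =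
      algebraMap K L (a ^ (Module.finrank K L - 1) * traceCoord K b v i) := by
  simp_rw [← algebraMap_smul L a (_ : V)] at hb
  rw [geomSum, map_mul, traceCoord_apply, algebraMap_trace_eq_sum_pow hθ, LinearMap.sum_apply,
    map_sum, Finsupp.finsetSum_apply, Finset.mul_sum]
  refine Finset.sum_congr rfl fun k hk => ?_
  have hpow : a ^ (Module.finrank K L - 1) = a ^ (Module.finrank K L - 1 - k) * a ^ k := by
    rw [← pow_add, Nat.sub_add_cancel (Nat.le_sub_one_of_lt (Finset.mem_range.1 hk))]
  rw [smul_pow, one_pow, mul_smul_comm, mul_one, LinearMap.smul_apply, repr_smul_of_tower,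
    repr_pow_apply hf hb, hpow, map_mul, Algebra.smul_def, mul_assoc]
  simp only [AlgEquiv.commutes, Finset.prod_const, Finset.card_range, map_pow]

theorem ker_geomSum_eq_eigenrange [Finite ι] (hθ : ∀ τ, τ ∈ Subgroup.zpowers θ)
    (hf : ∀ (x : L) (v : V), f (x • v) = θ x • f v) {a : K} (ha : a ≠ 0)
    (hb : ∀ i, f (b i) = a • b i) :
    LinearMap.ker (geomSum f a (Module.finrank K L)) = eigenrange f a := by
  ext v
  rw [eigenrange_eq_ker_traceCoord hθ hf ha hb, LinearMap.mem_ker, LinearMap.mem_ker,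
    ← b.repr.map_eq_zero_iff, Finsupp.ext_iff, funext_iff]
  simp [repr_geomSum_apply hθ hf hb, ha]

theorem exists_pow_finrank_eq_smul [Fintype ι] [FiniteDimensional K V]
    (hθ : ∀ τ, τ ∈ Subgroup.zpowers θ)
    (hf : ∀ (x : L) (v : V), f (x • v) = θ x • f v) {c : L} (hc : c ≠ 0)
    (hb : ∀ i, f (b i) = c • b i) :
    ∃ n : K, f ^ Module.finrank K L = n • 1 ∧ ∀ a, a ^ Module.finrank K L = n →
      Module.finrank K (eigenrange f a) + Fintype.card ι = Module.finrank K V ∧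
      LinearMap.ker (geomSum f a (Module.finrank K L)) = eigenrange f a := by
  refine ⟨_, pow_finrank_eq_norm_smul hθ hf hb, fun a hac => ?_⟩
  have ha : a ≠ 0 := fun ha => Algebra.norm_ne_zero_iff.2 hc <| by
    rw [← hac, ha, zero_pow Module.finrank_pos.ne']
  obtain ⟨b', hb'⟩ := exists_basis_apply_eq_smul hθ hf hb ha hac
  exact ⟨finrank_eigenrange_add_card hθ hf ha hb', ker_geomSum_eq_eigenrange hθ hf ha hb'⟩

end Semilinear

section HwiseFixed

variable {K V : Type*} [Field K] [AddCommGroup V] [Module K V] {g : V ≃ₗ[K] V}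

theorem exists_apply_eq_mul_of_fixes_ker {ψ : Module.Dual K V} (h : Fixes g (LinearMap.ker ψ)) :
    ∃ c : K, ∀ v, ψ (g v) = c * ψ v := by
  rcases eq_or_ne ψ 0 with rfl | hψ
  · exact ⟨0, by simp⟩
  obtain ⟨w, hw⟩ : ∃ w, ψ w = 1 := LinearMap.surjective hψ 1
  refine ⟨ψ (g w), fun v => ?_⟩
  have hker : v - ψ v • w ∈ LinearMap.ker ψ := by
    rw [LinearMap.mem_ker, map_sub, map_smul, hw, smul_eq_mul, mul_one, sub_self]
  have hgker : ψ (g (v - ψ v • w)) = 0 := h.le (Submodule.mem_map_of_mem hker)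
  rw [map_sub, map_sub, map_smul, map_smul, smul_eq_mul, sub_eq_zero] at hgker
  rw [hgker, mul_comm]

variable [FiniteDimensional K V]

theorem fixes_of_eigenrange_le {a : K} {H : Submodule K V} (hH : eigenrange (g : V →ₗ[K] V) a ≤ H) :
    Fixes g H := by
  refine Submodule.eq_of_le_of_finrank_eq (Submodule.map_le_iff_le_comap.2 fun v hv => ?_)
    (LinearEquiv.finrank_map_eq g H)
  have := H.add_mem (hH (apply_sub_smul_mem_eigenrange _ a v)) (H.smul_mem a hv)
  rwa [sub_add_cancel] at this

theorem exists_eigenrange_le_of_forall_fixes {U : Submodule K V}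
    (hU : ∀ H : Submodule K V, Module.finrank K H + 1 = Module.finrank K V → U ≤ H → Fixes g H) :
    ∃ a : K, eigenrange (g : V →ₗ[K] V) a ≤ U := by
  have hdual (ψ : Module.Dual K V) (hψ : ψ ∈ U.dualAnnihilator) :
      ∃ c : K, (g : V →ₗ[K] V).dualMap ψ = c • ψ := by
    by_cases hψ0 : ψ = 0
    · exact ⟨0, by simp [hψ0]⟩
    obtain ⟨c, hc⟩ := exists_apply_eq_mul_of_fixes_ker
      (hU _ (Module.Dual.finrank_ker_add_one_of_ne_zero hψ0)
        ((Submodule.mem_dualAnnihilator ψ).1 hψ))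
    exact ⟨c, LinearMap.ext hc⟩
  obtain ⟨a, ha⟩ : ∃ a : K, ∀ ψ ∈ U.dualAnnihilator, (g : V →ₗ[K] V).dualMap ψ = a • ψ :=
    exists_forall_mem_apply_eq_smul hdual
  refine ⟨a, ?_⟩
  rintro _ ⟨v, rfl⟩
  refine (Subspace.forall_mem_dualAnnihilator_apply_eq_zero_iff U _).1 fun ψ hψ => ?_
  have hψv : ψ (g v) = a * ψ v := LinearMap.congr_fun (ha ψ hψ) v
  simp [hψv]

theorem isHwiseFixed5Space_iff (hV : Module.finrank K V = 9) {U : Submodule K V} :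
    IsHwiseFixed5Space g U ↔ HasProjDim U 5 ∧ ∃ a : K, eigenrange (g : V →ₗ[K] V) a ≤ U := by
  refine and_congr_right fun _ => ⟨fun hU => ?_, fun ⟨a, ha⟩ H _ hH => ?_⟩
  · refine exists_eigenrange_le_of_forall_fixes fun H hH => hU H ?_
    unfold HasProjDim
    omega
  · exact fixes_of_eigenrange_le (ha.trans hH)

theorem IsHwiseFixed5Space.fixes (hV : Module.finrank K V = 9) {U : Submodule K V}
    (hU : IsHwiseFixed5Space g U) : Fixes g U := by
  obtain ⟨-, a, ha⟩ := (isHwiseFixed5Space_iff hV).1 hU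
  exact fixes_of_eigenrange_le ha

theorem isHwiseFixed5Space_iff_exists_eq_eigenrange (hV : Module.finrank K V = 9) {n : K}
    (hg : (g : V →ₗ[K] V) ^ 3 = n • 1)
    (hdim : ∀ a : K, a ^ 3 = n → HasProjDim (eigenrange (g : V →ₗ[K] V) a) 5) {U : Submodule K V} :
    IsHwiseFixed5Space g U ↔ ∃ a : K, a ^ 3 = n ∧ eigenrange (g : V →ₗ[K] V) a = U := by
  rw [isHwiseFixed5Space_iff hV]
  constructor
  · rintro ⟨hU, a, ha⟩
    have han : a ^ 3 = n := by
      by_contra han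
      rw [eigenrange_eq_top_of_pow_ne hg han, top_le_iff] at ha
      rw [ha, HasProjDim, finrank_top, hV] at hU
      omega
    exact ⟨a, han, Submodule.eq_of_le_of_finrank_eq ha ((hdim a han).trans hU.symm)⟩
  · rintro ⟨a, han, rfl⟩
    exact ⟨hdim a han, a, le_rfl⟩

theorem existsUnique_isHwiseFixed5Space_mem (hV : Module.finrank K V = 9) {n : K}
    (hg : (g : V →ₗ[K] V) ^ 3 = n • 1)
    (hdim : ∀ a : K, a ^ 3 = n → HasProjDim (eigenrange (g : V →ₗ[K] V) a) 5)
    (hker : ∀ a : K, a ^ 3 = n →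
      LinearMap.ker (geomSum (g : V →ₗ[K] V) a 3) = eigenrange (g : V →ₗ[K] V) a)
    {v : V} (hli : LinearIndependent K ![v, g v]) (hmem : g (g v) ∈ Submodule.span K {v, g v}) :
    ∃! U : Submodule K V, IsHwiseFixed5Space g U ∧ v ∈ U := by
  obtain ⟨a, ⟨han, ha⟩, huniq⟩ := existsUnique_geomSum_three_apply_eq_zero hg hli hmem
  simp only [isHwiseFixed5Space_iff_exists_eq_eigenrange hV hg hdim]
  refine ⟨_, ⟨⟨a, han, rfl⟩, (hker a han).le ha⟩, ?_⟩
  rintro _ ⟨⟨c, hcn, rfl⟩, hc⟩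
  rw [huniq c ⟨hcn, (hker c hcn).ge hc⟩]

end HwiseFixed

section Points

variable {K V : Type*} [Field K] [AddCommGroup V] [Module K V] {g : V ≃ₗ[K] V}

theorem linearIndependent_of_mk_ne_proj {v : V} (hv : v ≠ 0)
    (h : Projectivization.mk K v hv ≠ proj g (Projectivization.mk K v hv)) :
    LinearIndependent K ![v, g v] :=
  (Projectivization.independent_mk_iff_LinearIndependent hv (g.map_ne_zero_iff.2 hv)).1
    ((Projectivization.independent_pair_iff_ne _ _).2 h)

theorem apply_apply_mem_span_of_collinearPoints {v : V} (hv : v ≠ 0)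
    (hli : LinearIndependent K ![v, g v])
    (h : CollinearPoints (Projectivization.mk K v hv) (proj g (Projectivization.mk K v hv))
      (proj g (proj g (Projectivization.mk K v hv)))) :
    g (g v) ∈ Submodule.span K {v, g v} := by
  obtain ⟨M, hfin, hM, hsub⟩ := h
  have hgv : g v ≠ 0 := g.map_ne_zero_iff.2 hv
  have hvM : v ∈ M.submodule := (M.mem_submodule_iff hv).2 (hsub (by simp))
  have hgvM : g v ∈ M.submodule := (M.mem_submodule_iff hgv).2 (hsub (.inr (.inl rfl)))
  have hggvM : g (g v) ∈ M.submodule :=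
    (M.mem_submodule_iff (g.map_ne_zero_iff.2 hgv)).2 (hsub (.inr (.inr rfl)))
  have hle : Submodule.span K {v, g v} ≤ M.submodule :=
    Submodule.span_le.2 (Set.pair_subset hvM hgvM)
  have hspan : Module.finrank K (Submodule.span K {v, g v}) = 2 := by
    rw [← Matrix.range_cons_cons_empty v (g v) ![], finrank_span_eq_card hli, Fintype.card_fin]
  rwa [Submodule.eq_of_le_of_finrank_le hle (by omega)]

theorem submodule_le_iff_of_fixes {A : ℙ K V} (hA : A ≠ proj g A) {l U : Submodule K V}
    (hdim : HasProjDim l 1) (hl : Fixes g l) (hU : Fixes g U) (hAl : A.submodule ≤ l) :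
    l ≤ U ↔ A.submodule ≤ U := by
  induction A using Projectivization.ind with | h v hv =>
  simp only [Projectivization.submodule_mk, Submodule.span_singleton_le_iff_mem] at hAl ⊢
  refine ⟨fun h => h hAl, fun hvU => ?_⟩
  have hgvl : g v ∈ l := hl.le (Submodule.mem_map_of_mem hAl)
  rw [Projectivization.line_unique' hv (g.map_ne_zero_iff.2 hv)
    (linearIndependent_of_mk_ne_proj hv hA) l hdim
    ((Submodule.mk_mem_projectivization_iff _ _).2 hAl)
    ((Submodule.mk_mem_projectivization_iff _ _).2 hgvl), Submodule.span_le]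
  exact Set.pair_subset hvU (hU.le (Submodule.mem_map_of_mem hvU))

end Points

section Induced

variable {K L V : Type*} [Field K] [Field L] [Algebra K L] [AddCommGroup V] [Module L V]
  [Module K V] [IsScalarTower K L V] {φ : Equiv.Perm (ℙ L V)} {g : V ≃ₗ[K] V}

theorem eq_mk_of_mem_submodule {P : ℙ L V} {v : V} (hv : v ≠ 0) (h : v ∈ P.submodule) :
    P = Projectivization.mk L v hv := by
  induction P using Projectivization.ind with | h w hw =>
  rw [Projectivization.submodule_mk, Submodule.mem_span_singleton] at h
  exact ((Projectivization.mk_eq_mk_iff' L _ _ hv hw).2 h).symm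

theorem IsInducedBy.apply_mem (hg : IsInducedBy g φ) {P : ℙ L V} {v : V} (hv : v ∈ P.submodule) :
    g v ∈ (φ P).submodule :=
  (hg P).le (Submodule.mem_map_of_mem (p := spreadPlane K P) hv)

theorem IsInducedBy.apply_mk (hg : IsInducedBy g φ) {v : V} (hv : v ≠ 0) :
    φ (Projectivization.mk L v hv) = Projectivization.mk L (g v) (g.map_ne_zero_iff.2 hv) :=
  eq_mk_of_mem_submodule _ (hg.apply_mem (Submodule.mem_span_singleton_self v))

theorem IsInducedBy.map_smul_mem_span (hg : IsInducedBy g φ) (x : L) (v : V) :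
    g (x • v) ∈ Submodule.span L {g v} := by
  by_cases hv : v = 0
  · simp [hv]
  have hxv : x • v ∈ (Projectivization.mk L v hv).submodule :=
    Submodule.smul_mem _ x (Submodule.mem_span_singleton_self v)
  simpa only [hg.apply_mk, Projectivization.submodule_mk] using hg.apply_mem hxv

theorem IsInducedBy.exists_basis_apply_eq_smul (hg : IsInducedBy g φ) {S : Set (ℙ L V)}
    (hS : IsSubplane K S) (hφS : ∀ P ∈ S, φ P = P) :
    ∃ (b : Module.Basis (Fin 3) L V) (c : L), c ≠ 0 ∧ ∀ i, g (b i) = c • b i := by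
  obtain ⟨b, rfl⟩ := hS
  have hspan (k : Fin 3 → K) : g (∑ i, algebraMap K L (k i) • b i) ∈
      Submodule.span L {∑ i, algebraMap K L (k i) • b i} := by
    by_cases hk : ∑ i, algebraMap K L (k i) • b i = 0
    · rw [hk, map_zero]
      exact Submodule.zero_mem _
    have := hg.apply_mem (P := Projectivization.mk L _ hk) (Submodule.mem_span_singleton_self _)
    rwa [hφS _ ⟨k, hk, rfl⟩] at this
  obtain ⟨c, hc⟩ := exists_forall_apply_basis_eq_smul (g := g.toAddMonoidHom) b
    (fun i => by
      simpa [Pi.single_apply, apply_ite (algebraMap K L), ite_smul] using hspan (Pi.single i 1))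
    (by simpa using hspan 1)
  refine ⟨b, c, ?_, hc⟩
  rintro rfl
  exact g.map_ne_zero_iff.2 (b.ne_zero 0) ((hc 0).trans (zero_smul L _))

theorem IsInducedBy.exists_algEquiv_map_smul [FiniteDimensional K L] (hg : IsInducedBy g φ)
    {u w : V} (huw : LinearIndependent L ![g u, g w]) :
    ∃ θ : Gal(L/K), ∀ (x : L) (v : V), g (x • v) = θ x • g v := by
  obtain ⟨θ, hθ⟩ := exists_algHom_map_smul (g := (g : V →ₗ[K] V)) hg.map_smul_mem_span huw
  exact ⟨AlgEquiv.ofBijective θ θ.bijective, hθ⟩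

theorem IsInducedBy.ne_one_of_map_smul (hg : IsInducedBy g φ) (hφ : φ ≠ 1) {θ : Gal(L/K)}
    (hθ : ∀ (x : L) (v : V), g (x • v) = θ x • g v) {ι : Type*}
    {b : Module.Basis ι L V} {c : L} (hb : ∀ i, g (b i) = c • b i) : θ ≠ 1 := by
  rintro rfl
  have hgc (v : V) : g v = c • v := b.repr.injective <| Finsupp.ext fun i => by
    exact (repr_apply (f := (g : V →ₗ[K] V)) hθ hb v i).trans (by rw [map_smul]; rfl)
  refine hφ (Equiv.ext fun P => ?_)
  induction P using Projectivization.ind with | h v hv =>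
  rw [hg.apply_mk]
  exact (Projectivization.mk_eq_mk_iff' L _ _ _ hv).2 ⟨c, (hgc v).symm⟩

theorem IsIIPoint.ne_proj (hg : IsInducedBy g φ) {A : ℙ K V} (hA : IsIIPoint φ A) :
    A ≠ proj g A := by
  obtain ⟨P, hP, hAP⟩ := hA
  intro h
  induction A using Projectivization.ind with | h v hv =>
  have hvP : v ∈ P.submodule := hAP (Submodule.mem_span_singleton_self v)
  obtain ⟨k, hk⟩ := (Projectivization.mk_eq_mk_iff' K v (g v) hv (g.map_ne_zero_iff.2 hv)).1 h
  have hvφP : v ∈ spreadPlane K (φ P) := hk ▸ Submodule.smul_mem _ k (hg.apply_mem hvP)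
  exact hP.1 ((eq_mk_of_mem_submodule hv hvP).trans (eq_mk_of_mem_submodule hv hvφP).symm)

theorem IsInducedBy.ne_proj_and_collinearPoints (hg : IsInducedBy g φ) {A : ℙ K V}
    (hA : IsIColonPoint φ g A ∨ IsIIColonPoint φ g A) :
    A ≠ proj g A ∧ CollinearPoints A (proj g A) (proj g (proj g A)) :=
  hA.elim (fun hI => ⟨hI.2.1, hI.2.2.2.2⟩) fun hII => ⟨hII.1.ne_proj hg, hII.2⟩

theorem IsInducedBy.existsUnique_isHwiseFixed5Space_submodule_le (hg : IsInducedBy g φ)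
    (hL : Module.finrank K L = 3) (hVK : Module.finrank K V = 9) (hφ : φ ≠ 1) {S : Set (ℙ L V)}
    (hS : IsSubplane K S) (hφS : ∀ P ∈ S, φ P = P) {A : ℙ K V} (hne : A ≠ proj g A)
    (hcol : CollinearPoints A (proj g A) (proj g (proj g A))) :
    ∃! U : Submodule K V, IsHwiseFixed5Space g U ∧ A.submodule ≤ U := by
  have : FiniteDimensional K V := .of_finrank_pos (by omega)
  have : FiniteDimensional K L := .of_finrank_pos (by omega)
  have hprime : (Module.finrank K L).Prime := hL ▸ Nat.prime_three
  obtain ⟨b, c, hc, hb⟩ := hg.exists_basis_apply_eq_smul hS hφS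
  have hbli : LinearIndependent L ![g (b 0), g (b 1)] := by
    rw [hb, hb, LinearIndependent.pair_smul_iff hc]
    have hcomp : ![b 0, b 1] = b ∘ ![0, 1] := funext (Fin.forall_fin_two.2 ⟨rfl, rfl⟩)
    exact hcomp ▸ b.linearIndependent.comp _ (by decide)
  obtain ⟨θ, hsemi⟩ := hg.exists_algEquiv_map_smul hbli
  have hθ : θ ≠ 1 := hg.ne_one_of_map_smul hφ hsemi hb
  have := isGalois_of_prime_finrank_of_ne_one hprime hθ
  obtain ⟨n, hn, hroot⟩ := exists_pow_finrank_eq_smul (f := (g : V →ₗ[K] V))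
    (mem_zpowers_of_prime_finrank hprime hθ) hsemi hc hb
  simp only [hL, hVK, Fintype.card_fin] at hn hroot
  induction A using Projectivization.ind with | h v hv =>
  have hli := linearIndependent_of_mk_ne_proj hv hne
  simpa only [Projectivization.submodule_mk, Submodule.span_singleton_le_iff_mem] using
    existsUnique_isHwiseFixed5Space_mem hVK hn (fun a ha => by
      have := (hroot a ha).1
      unfold HasProjDim
      omega) (fun a ha => (hroot a ha).2) hli (apply_apply_mem_span_of_collinearPoints hv hli hcol)

theorem exists_colonPoint_of_isFixedLine {l : Submodule K V}
    (hl : IsFixedILine φ g l ∨ IsFixedIILine φ g l) :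
    HasProjDim l 1 ∧ Fixes g l ∧
      ∃ A : ℙ K V, (IsIColonPoint φ g A ∨ IsIIColonPoint φ g A) ∧ A.submodule ≤ l := by
  rcases hl with ⟨hdim, hfix, A, hA, hAl⟩ | ⟨hdim, hfix, A, hA, hAl⟩
  exacts [⟨hdim, hfix, A, .inl hA, hAl⟩, ⟨hdim, hfix, A, .inr hA, hAl⟩]

end Induced

end FieldReduction

theorem theorem10_general {K L V : Type*} [Field K]
    [Field L] [Algebra K L] (hL : Module.finrank K L = 3)
    [AddCommGroup V] [Module L V] [Module K V] [IsScalarTower K L V]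
    (hV : Module.finrank L V = 3)
    (φ : Equiv.Perm (ℙ L V)) (hφ : φ ≠ 1)
    (S : Set (ℙ L V)) (hS : FieldReduction.IsSubplane K S) (hφS : ∀ P ∈ S, φ P = P)
    (σ : V ≃ₗ[K] V) (hσ : FieldReduction.IsInducedBy σ φ) :
    (∀ A : ℙ K V, FieldReduction.IsIColonPoint φ σ A ∨ FieldReduction.IsIIColonPoint φ σ A →
      ∃! U : Submodule K V, FieldReduction.IsHwiseFixed5Space σ U ∧ A.submodule ≤ U) ∧
    (∀ l : Submodule K V, FieldReduction.IsFixedILine φ σ l ∨ FieldReduction.IsFixedIILine φ σ l →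
      ∃! U : Submodule K V, FieldReduction.IsHwiseFixed5Space σ U ∧ l ≤ U) := by
  have hVK : Module.finrank K V = 9 := by rw [← Module.finrank_mul_finrank K L V, hL, hV]
  have : FiniteDimensional K V := .of_finrank_pos (by omega)
  have hpoint (A : ℙ K V)
      (hA : FieldReduction.IsIColonPoint φ σ A ∨ FieldReduction.IsIIColonPoint φ σ A) :
      ∃! U : Submodule K V, FieldReduction.IsHwiseFixed5Space σ U ∧ A.submodule ≤ U := by
    obtain ⟨hne, hcol⟩ := hσ.ne_proj_and_collinearPoints hA
    exact hσ.existsUnique_isHwiseFixed5Space_submodule_le hL hVK hφ hS hφS hne hcol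
  refine ⟨hpoint, fun l hl => ?_⟩
  obtain ⟨hdim, hfix, A, hA, hAl⟩ := FieldReduction.exists_colonPoint_of_isFixedLine hl
  have hne : A ≠ FieldReduction.proj σ A := (hσ.ne_proj_and_collinearPoints hA).1
  refine (existsUnique_congr fun U => and_congr_right fun hU => ?_).2 (hpoint A hA)
  exact FieldReduction.submodule_le_iff_of_fixes hne hdim hfix (hU.fixes hVK) hAl

theorem theorem10 (q : ℕ) (hq : 2 < q)
    {K L V : Type*} [Field K] [Finite K] (hK : Nat.card K = q)
    [Field L] [Algebra K L] (hL : Module.finrank K L = 3)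
    [AddCommGroup V] [Module L V] [Module K V] [IsScalarTower K L V]
    (hV : Module.finrank L V = 3)
    (φ : Equiv.Perm (ℙ L V)) (hφ : FieldReduction.IsCollineation φ) (hφ3 : orderOf φ = 3)
    (S : Set (ℙ L V)) (hS : FieldReduction.IsSubplane K S) (hφS : ∀ P ∈ S, φ P = P)
    (σ : V ≃ₗ[K] V) (hσ : FieldReduction.IsInducedBy σ φ) :
    (∀ A : ℙ K V, FieldReduction.IsIColonPoint φ σ A ∨ FieldReduction.IsIIColonPoint φ σ A →
      ∃! U : Submodule K V, FieldReduction.IsHwiseFixed5Space σ U ∧ A.submodule ≤ U) ∧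
    (∀ l : Submodule K V, FieldReduction.IsFixedILine φ σ l ∨ FieldReduction.IsFixedIILine φ σ l →
      ∃! U : Submodule K V, FieldReduction.IsHwiseFixed5Space σ U ∧ l ≤ U) :=
  theorem10_general hL hV φ (by rintro rfl; simp at hφ3) S hS hφS σ hσ
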